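/- Let $R$ be a commutative Artinian ring and let $A$ be an Artin $R$-algebra, that is, an $R$-algebra which is finitely generated as an $R$-module. All modules are left modules unless stated otherwise. A finitely generated $A$-module $M$ is called Gorenstein projective if there is an exact sequence $$\cdots \to P_1 \to P_0 \to P^0 \to P^1 \to \cdots$$ of finitely generated projective $A$-modules which remains exact under $\operatorname{Hom}_A(-,Q)$ for every finitely generated projective $A$-module $Q$, such that $M \cong \operatorname{Im}(P_0 \to P^0)$. Let $\mathcal{GP}(A)$ be the class of these modules. The algebra $A$ is called CM-finite if $\mathcal{GP}(A)$ contains only finitely many indecomposable modules up to isomorphism. For a natural number $n$, $A$ is called $n$-Gorenstein if it is left and right Noetherian, the injective dimensions $\operatorname{id}({}_AA)$ and $\operatorname{id}(A_A)$ are both finite, and $\operatorname{id}({}_AA) \le n$. Let $n \ge 2$, suppose that $A$ is CM-finite and $n$-Gorenstein, and let $E$ be a finitely generated $A$-module such that $\mathcal{GP}(A) = \operatorname{add} E$, where $\operatorname{add} E$ is the class of all direct summands of finite direct sums of copies of $E$. Then $$\operatorname{gl.dim}\, \operatorname{End}_A E \le n,$$ where $\operatorname{End}_A E$ acts on $E$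 from the right (so that $E$ is an $A$-$\operatorname{End}_A E$-bimodule) and $\operatorname{gl.dim} B$ is the supremum of the projective dimensions of all left $B$-modules. -/

import Mathlib

open CategoryTheory

universe u v

namespace GorensteinArtin

/-- The (left) global dimension of a ring `B`: the supremum of the projective dimensions of all
left `B`-modules, with values in `WithBot ℕ∞` (it is `⊥` exactly for the zero ring). -/
noncomputable def globalDimension (B : Type u) [Ring B] : WithBot ℕ∞ :=
  ⨆ M : ModuleCat.{u} B, projectiveDimension M

/-- `M` lies in `add E`: it is a direct summand of a finite direct sum of copies of `E`. -/
def InAdd (A : Type u) [Ring A] (E M : Type u) [AddCommGroup E] [Module A E]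
    [AddCommGroup M] [Module A M] : Prop :=
  ∃ (k : ℕ) (N : ModuleCat.{u} A), Nonempty ((M × N) ≃ₗ[A] (Fin k → E))

/-- A complete projective resolution in the category of finitely generated left `A`-modules:
an exact sequence `⋯ → P i → P (i + 1) → P (i + 2) → ⋯`, indexed by `ℤ`, of finitely generated
projective modules which stays exact after applying `Hom_A(-, Q)` for every finitely generated
projective module `Q`. -/
structure CompleteResolution (A : Type u) [Ring A] where
  /-- the terms -/
  P : ℤ → ModuleCat.{u} A
  /-- the differentials -/
  d : ∀ i : ℤ, P i →ₗ[A] P (i + 1)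
  finite : ∀ i, Module.Finite A (P i)
  projective : ∀ i, Module.Projective A (P i)
  exact : ∀ i, Function.Exact (d i) (d (i + 1))
  hom_exact : ∀ (Q : ModuleCat.{u} A), Module.Finite A Q → Module.Projective A Q → ∀ i,
    Function.Exact (fun g : P (i + 1 + 1) →ₗ[A] Q => g ∘ₗ d (i + 1))
      (fun g : P (i + 1) →ₗ[A] Q => g ∘ₗ d i)

/-- A left `A`-module is (finitely generated) Gorenstein projective if it is isomorphic to the
image of a differential of a complete projective resolution. -/
def IsGorensteinProjective (A : Type u) [Ring A] (M : Type u) [AddCommGroup M] [Module A M] :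
    Prop :=
  ∃ C : CompleteResolution A, Nonempty (M ≃ₗ[A] LinearMap.range (C.d 0))

/-- `GP(A) = add E`: a finitely generated left `A`-module is Gorenstein projective if and only if
it is a direct summand of a finite direct sum of copies of `E`. -/
def GorensteinProjectivesEqAdd (A : Type u) [Ring A] (E : Type u) [AddCommGroup E] [Module A E] :
    Prop :=
  ∀ M : ModuleCat.{u} A, Module.Finite A M → (IsGorensteinProjective A M ↔ InAdd A E M)

/-- `A` is CM-finite: up to isomorphism there are only finitely many indecomposable finitely
generated Gorenstein projective left `A`-modules. -/
def IsCMFinite (A : Type u) [Ring A] : Prop :=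
  ∃ (k : ℕ) (X : Fin k → ModuleCat.{u} A), ∀ M : ModuleCat.{u} A, Module.Finite A M →
    IsGorensteinProjective A M → Indecomposable M → ∃ i, Nonempty (M ≅ X i)

/-- A Gorenstein ring: left and right Noetherian, and of finite injective dimension both as a left
module and as a right module over itself. -/
structure IsGorensteinRing (A : Type u) [Ring A] : Prop where
  left_noetherian : IsNoetherianRing A
  right_noetherian : IsNoetherianRing Aᵐᵒᵖ
  left_finite : injectiveDimension (ModuleCat.of A A) < ⊤
  right_finite : injectiveDimension (ModuleCat.of Aᵐᵒᵖ A) < ⊤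

/-- An `n`-Gorenstein ring: a Gorenstein ring whose injective dimension as a left module over
itself is at most `n`. -/
structure IsNGorenstein (A : Type u) [Ring A] (n : ℕ) : Prop extends IsGorensteinRing A where
  left_le : injectiveDimension (ModuleCat.of A A) ≤ n

end GorensteinArtin

/-! Write B for the opposite of End_A E, so that B = Hom_A(E, E) as a left B-module. By Auslander's
theorem it is enough to bound the projective dimension of B/I for left ideals I. B is Noetherian, so
I has r generators, and these amount to a map G : E^r → E; then Hom_A(E, ker G) is a second syzygy
of B/I.

Over a Gorenstein ring the finitely generated X with Ext^i(X, A) = 0 for all i > 0 are exactly the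
Gorenstein projectives, hence form add E (`ExtAcyclic.isGorensteinProjective`,
`IsGorensteinProjective.extAcyclic`). Duality into A proves the harder inclusion: such X are
reflexive and embed in free modules with cokernel of the same kind.

If id A ≤ n, shifting twice from coker G gives Ext^i(ker G, A) = 0 for i > n - 2. Covering by powers
of E lowers this bound by one each time; since A lies in add E, the covers are surjective. After n -
2 steps the kernel is in add E, where Hom_A(E, -) has projective values
(`hasProjectiveDimensionLE_hom`). With the first two syzygies this totals n. -/

namespace GorensteinArtin

open Abelian

/-! ### Dimension shifting for Ext and extension of maps -/

section Ext

variable {A : Type u} [Ring A] {X Y Z T : Type u} [AddCommGroup X] [Module A X]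
  [AddCommGroup Y] [Module A Y] [AddCommGroup Z] [Module A Z] [AddCommGroup T] [Module A T]

/-- The vanishing of `Ext^i_A(X, T)`. -/
def ExtVanishes (A : Type u) [Ring A] (X T : Type u) [AddCommGroup X] [Module A X]
    [AddCommGroup T] [Module A T] (i : ℕ) : Prop :=
  Subsingleton (Ext (ModuleCat.of A X) (ModuleCat.of A T) i)

/-- The sequence `0 → X → Y → Z → 0` is exact. -/
structure IsShortExact (f : X →ₗ[A] Y) (g : Y →ₗ[A] Z) : Prop where
  injective : Function.Injective f
  exact : Function.Exact f g
  surjective : Function.Surjective g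

/-- Every linear map from `X` to `T` extends along `f : X → Y`. -/
def Extends (T : Type u) [AddCommGroup T] [Module A T] (f : X →ₗ[A] Y) : Prop :=
  ∀ h : X →ₗ[A] T, ∃ k : Y →ₗ[A] T, k ∘ₗ f = h

theorem isShortExact_ker {g : Y →ₗ[A] Z} (hg : Function.Surjective g) :
    IsShortExact (LinearMap.ker g).subtype g :=
  ⟨Subtype.val_injective, LinearMap.exact_subtype_ker_map g, hg⟩

theorem isShortExact_range {f : X →ₗ[A] Y} (hf : Function.Injective f) :
    IsShortExact f (LinearMap.range f).mkQ :=
  ⟨hf, LinearMap.exact_map_mkQ_range f, Submodule.mkQ_surjective _⟩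

namespace IsShortExact

variable {f : X →ₗ[A] Y} {g : Y →ₗ[A] Z} (h : IsShortExact f g)
include h

theorem shortExact : (ModuleCat.shortComplexOfCompEqZero f g h.exact.linearMap_comp_eq_zero).ShortExact :=
  ModuleCat.shortComplex_shortExact _ h.exact h.injective h.surjective

theorem extVanishes_right {i : ℕ} (hX : ExtVanishes A X T i) (hY : ExtVanishes A Y T (i + 1)) :
    ExtVanishes A Z T (i + 1) := by
  refine subsingleton_of_forall_eq 0 fun x => ?_
  obtain ⟨y, rfl⟩ := Ext.contravariant_sequence_exact₃ h.shortExact (ModuleCat.of A T) x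
    (hY.elim _ _) (add_comm 1 i)
  rw [hX.elim y 0, Ext.comp_zero]

theorem extVanishes_left {i : ℕ} (hY : ExtVanishes A Y T i) (hZ : ExtVanishes A Z T (i + 1)) :
    ExtVanishes A X T i := by
  refine subsingleton_of_forall_eq 0 fun x => ?_
  obtain ⟨y, rfl⟩ := Ext.contravariant_sequence_exact₁ h.shortExact (ModuleCat.of A T) x
    (add_comm 1 i) (hZ.elim _ _)
  rw [hY.elim y 0, Ext.comp_zero]

theorem extends_of_extVanishes (hZ : ExtVanishes A Z T 1) : Extends T f := by
  intro k
  obtain ⟨y, hy⟩ := Ext.contravariant_sequence_exact₁ h.shortExact (ModuleCat.of A T)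
    (Ext.mk₀ (ModuleCat.ofHom k)) (add_comm 1 0) (hZ.elim _ _)
  obtain ⟨y, rfl⟩ := Ext.addEquiv₀.symm.surjective y
  refine ⟨y.hom, ?_⟩
  erw [Ext.mk₀_comp_mk₀] at hy
  have := congrArg ModuleCat.Hom.hom (Ext.addEquiv₀.symm.injective hy)
  exact this

/-- As Ext^1(Y, T) = 0, every class in Ext^1(Z, T) is the connecting image of a map X → T, and that
image is zero once the map extends to Y. -/
theorem extVanishes_one_of_extends (hY : ExtVanishes A Y T 1) (hT : Extends T f) :
    ExtVanishes A Z T 1 := by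
  refine subsingleton_of_forall_eq 0 fun x => ?_
  obtain ⟨y, rfl⟩ := Ext.contravariant_sequence_exact₃ h.shortExact (ModuleCat.of A T) x
    (hY.elim _ _) (add_comm 1 0)
  obtain ⟨y, rfl⟩ := Ext.addEquiv₀.symm.surjective y
  obtain ⟨k, hk⟩ := hT y.hom
  have : Ext.addEquiv₀.symm y = (Ext.mk₀ (ModuleCat.ofHom f)).comp
      (Ext.mk₀ (ModuleCat.ofHom k)) (zero_add 0) := by
    rw [Ext.mk₀_comp_mk₀]
    exact congrArg Ext.mk₀ (ModuleCat.hom_ext hk.symm)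
  rw [this]
  exact h.shortExact.extClass_comp_assoc _

/-- A linear map on the middle term that vanishes on the first one factors through the last. -/
theorem exists_factor (k : Y →ₗ[A] T) (hk : k ∘ₗ f = 0) : ∃ l : Z →ₗ[A] T, l ∘ₗ g = k := by
  let e := g.quotKerEquivOfSurjective h.surjective
  refine ⟨(LinearMap.ker g).liftQ k ?_ ∘ₗ e.symm.toLinearMap, ?_⟩
  · intro y hy
    obtain ⟨x, rfl⟩ := (h.exact y).1 hy
    exact LinearMap.congr_fun hk x
  · ext y
    have : e.symm (g y) = (LinearMap.ker g).mkQ y := by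
      rw [LinearEquiv.symm_apply_eq]; rfl
    simp [this]

end IsShortExact

theorem extVanishes_of_projective [hX : Module.Projective A X] (i : ℕ) :
    ExtVanishes A X T (i + 1) := by
  have : Projective (ModuleCat.of A X) := (IsProjective.iff_projective X).1 hX
  exact Ext.subsingleton_of_projective _ _ i

theorem ExtVanishes.congr {i : ℕ} (h : ExtVanishes A X T i) (e : X ≃ₗ[A] Y) :
    ExtVanishes A Y T i := by
  refine subsingleton_of_forall_eq 0 fun x => ?_
  have h1 : (Ext.mk₀ e.toModuleIso.hom).comp x (zero_add i) = 0 := h.elim _ _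
  have h2 : (Ext.mk₀ e.toModuleIso.inv).comp ((Ext.mk₀ e.toModuleIso.hom).comp x (zero_add i))
      (zero_add i) = x := by
    rw [Ext.mk₀_comp_mk₀_assoc, Iso.inv_hom_id, Ext.mk₀_id_comp]
  rw [← h2, h1, Ext.comp_zero]

/-- Extensions to `T` give extensions to every direct summand of a finite power of `T`. -/
theorem Extends.of_retract {f : X →ₗ[A] Y} (hT : Extends T f) {Q : Type u} [AddCommGroup Q]
    [Module A Q] {m : ℕ} (s : Q →ₗ[A] (Fin m → T)) (r : (Fin m → T) →ₗ[A] Q)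
    (hrs : r ∘ₗ s = LinearMap.id) : Extends Q f := by
  intro h
  choose k hk using fun i => hT (LinearMap.proj i ∘ₗ s ∘ₗ h)
  refine ⟨r ∘ₗ LinearMap.pi k, ?_⟩
  have : LinearMap.pi k ∘ₗ f = s ∘ₗ h := by
    ext x i
    exact LinearMap.congr_fun (hk i) x
  rw [LinearMap.comp_assoc, this, ← LinearMap.comp_assoc, hrs, LinearMap.id_comp]

end Ext

/-! ### Duality into the ring and reflexivity -/

section Duality

variable {A : Type u} [Ring A] {X Y Z : Type u} [AddCommGroup X] [Module A X]
  [AddCommGroup Y] [Module A Y] [AddCommGroup Z] [Module A Z]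

/-- `Ext^i_A(X, A) = 0` for all `i > 0`. -/
def ExtAcyclic (A : Type u) [Ring A] (X : Type u) [AddCommGroup X] [Module A X] : Prop :=
  ∀ i, ExtVanishes A X A (i + 1)

theorem IsShortExact.extAcyclic_left {f : X →ₗ[A] Y} {g : Y →ₗ[A] Z} (h : IsShortExact f g)
    (hY : ExtAcyclic A Y) (hZ : ExtAcyclic A Z) : ExtAcyclic A X :=
  fun i => h.extVanishes_left (hY i) (hZ (i + 1))

theorem IsShortExact.extAcyclic_right {f : X →ₗ[A] Y} {g : Y →ₗ[A] Z} (h : IsShortExact f g)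
    (hX : ExtAcyclic A X) (hY : ExtAcyclic A Y) (hf : Extends A f) : ExtAcyclic A Z := by
  rintro (_ | i)
  · exact h.extVanishes_one_of_extends (hY 0) hf
  · exact h.extVanishes_right (hX i) (hY (i + 1))

theorem extAcyclic_of_projective [Module.Projective A X] : ExtAcyclic A X :=
  fun i => extVanishes_of_projective i

/-- The dual of a short exact sequence is exact if linear maps to the ring extend. -/
theorem IsShortExact.dual {f : X →ₗ[A] Y} {g : Y →ₗ[A] Z} (h : IsShortExact f g)
    (hf : Extends A f) :
    IsShortExact (LinearMap.lcomp Aᵐᵒᵖ A g) (LinearMap.lcomp Aᵐᵒᵖ A f) where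
  injective k l hkl := by
    ext z
    obtain ⟨y, rfl⟩ := h.surjective z
    exact LinearMap.congr_fun hkl y
  exact k := by
    constructor
    · intro hk
      exact h.exists_factor k hk
    · rintro ⟨l, rfl⟩
      ext x
      have := h.exact.apply_apply_eq_zero x
      simp [this]
  surjective k := hf k

/-- A ring is free of rank one as a right module over itself. -/
def opSelfEquiv (A : Type u) [Ring A] : Aᵐᵒᵖ ≃ₗ[Aᵐᵒᵖ] A where
  toFun a := a.unop
  invFun := MulOpposite.op
  map_add' _ _ := rfl
  map_smul' _ _ := rfl
  left_inv _ := rfl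
  right_inv _ := rfl

/-- The dual of a finite free module is finite free. -/
def dualPiEquiv (A : Type u) [Ring A] (m : ℕ) :
    (Fin m → Aᵐᵒᵖ) ≃ₗ[Aᵐᵒᵖ] ((Fin m → A) →ₗ[A] A) :=
  (LinearEquiv.piCongrRight fun _ => opSelfEquiv A) ≪≫ₗ
    { toFun := fun a => ∑ i, (LinearMap.proj i : (Fin m → A) →ₗ[A] A).smulRight (a i)
      invFun := fun f i => f (Pi.single i 1)
      map_add' := fun a b => by ext i; simp [Pi.single_apply]
      map_smul' := fun c a => by ext i; simp [Pi.single_apply]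
      left_inv := fun a => by ext i; simp [Pi.single_apply]
      right_inv := fun f => by ext i; simp [Pi.single_apply] }

instance (m : ℕ) : Module.Free Aᵐᵒᵖ ((Fin m → A) →ₗ[A] A) :=
  Module.Free.of_equiv (dualPiEquiv A m)

instance (m : ℕ) : Module.Finite Aᵐᵒᵖ ((Fin m → A) →ₗ[A] A) :=
  Module.Finite.equiv (dualPiEquiv A m)

/-- The dual of a finite free module is spanned by the coordinates. -/
theorem dual_eq_sum {m : ℕ} (f : (Fin m → A) →ₗ[A] A) :
    f = ∑ i, MulOpposite.op (f (Pi.single i 1)) • (LinearMap.proj i : (Fin m → A) →ₗ[A] A) := by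
  ext i
  simp [Pi.single_apply]

theorem exists_eval_of_pi {m : ℕ} (ψ : ((Fin m → A) →ₗ[A] A) →ₗ[Aᵐᵒᵖ] A) :
    ∃ p : Fin m → A, ∀ f, ψ f = f p := by
  refine ⟨fun i => ψ (LinearMap.proj i), fun f => ?_⟩
  rw [dual_eq_sum f]
  simp

theorem finite_dual [IsNoetherianRing Aᵐᵒᵖ] [Module.Finite A X] :
    Module.Finite Aᵐᵒᵖ (X →ₗ[A] A) := by
  obtain ⟨m, π, hπ⟩ := Module.Finite.exists_fin' A X
  refine Module.Finite.of_injective (LinearMap.lcomp Aᵐᵒᵖ A π) fun k l hkl => ?_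
  ext z
  obtain ⟨y, rfl⟩ := hπ z
  exact LinearMap.congr_fun hkl y

/-- A finitely generated module with vanishing `Ext^i(-, A)` has a free cover whose kernel is again
such a module. -/
theorem ExtAcyclic.exists_cover [IsNoetherianRing A] [Module.Finite A X] (hX : ExtAcyclic A X) :
    ∃ (m : ℕ) (π : (Fin m → A) →ₗ[A] X), Function.Surjective π ∧
      ExtAcyclic A (LinearMap.ker π) := by
  obtain ⟨m, π, hπ⟩ := Module.Finite.exists_fin' A X
  exact ⟨m, π, hπ, (isShortExact_ker hπ).extAcyclic_left extAcyclic_of_projective hX⟩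

/-- The dual of a finitely generated module with vanishing `Ext^i(-, A)` has the same property on
the other side. -/
theorem ExtAcyclic.extVanishes_dual [IsNoetherianRing A] {d : ℕ}
    (hd : HasInjectiveDimensionLT (ModuleCat.of Aᵐᵒᵖ A) d) [Module.Finite A X]
    (hX : ExtAcyclic A X) (i : ℕ) : ExtVanishes Aᵐᵒᵖ (X →ₗ[A] A) A (i + 1) := by
  -- Induct on the distance k from i up to d. Dualizing a free cover of X with kernel K embeds X* in
  -- a free module with cokernel K*, so Ext^{i+1}(X*, A) is controlled by Ext^{i+2}(K*, A).
  have key : ∀ (k i : ℕ), d ≤ i + k → ∀ (X : Type u) [AddCommGroup X] [Module A X]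
      [Module.Finite A X], ExtAcyclic A X → ExtVanishes Aᵐᵒᵖ (X →ₗ[A] A) A (i + 1) := by
    intro k
    induction k with
    | zero =>
      intro i hi X _ _ _ _
      exact hd.subsingleton _ _ (i + 1) (by omega) _
    | succ k ih =>
      intro i hi X _ _ _ hX
      obtain ⟨m, π, hπ, hK⟩ := hX.exists_cover
      have hs := isShortExact_ker hπ
      exact (hs.dual (hs.extends_of_extVanishes (hX 0))).extVanishes_left
        (extVanishes_of_projective i) (ih (i + 1) (by omega) _ hK)
  exact key d i (by omega) X hX

/-- Evaluation to the bidual is surjective. -/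
theorem ExtAcyclic.exists_eval [IsNoetherianRing A] {d : ℕ}
    (hd : HasInjectiveDimensionLT (ModuleCat.of Aᵐᵒᵖ A) d) [Module.Finite A X]
    (hX : ExtAcyclic A X) (ψ : (X →ₗ[A] A) →ₗ[Aᵐᵒᵖ] A) : ∃ x : X, ∀ f, ψ f = f x := by
  obtain ⟨m, π, hπ, hK⟩ := hX.exists_cover
  have hs := isShortExact_ker hπ
  -- Ext^1(K*, A) = 0 lets ψ extend from X* to the dual of the free cover, where every functional is
  -- evaluation at a point.
  obtain ⟨Ψ, rfl⟩ := (hs.dual (hs.extends_of_extVanishes (hX 0))).extends_of_extVanishes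
    (hK.extVanishes_dual hd 0) ψ
  obtain ⟨p, hp⟩ := exists_eval_of_pi Ψ
  exact ⟨π p, fun f => hp _⟩

/-- Evaluation to the bidual is injective. -/
theorem ExtAcyclic.eq_zero_of_forall_dual [IsNoetherianRing A] {d : ℕ}
    (hd : HasInjectiveDimensionLT (ModuleCat.of Aᵐᵒᵖ A) d) [Module.Finite A X]
    (hX : ExtAcyclic A X) {x : X} (hx : ∀ f : X →ₗ[A] A, f x = 0) : x = 0 := by
  obtain ⟨m, π, hπ, hK⟩ := hX.exists_cover
  have hs := isShortExact_ker hπ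
  obtain ⟨p, rfl⟩ := hπ x
  have hdual := hs.dual (hs.extends_of_extVanishes (hX 0))
  -- Evaluation at p kills X*, so it descends to K*, where it is evaluation at some y in K. Then p
  -- and y have the same coordinates, so p lies in the kernel.
  obtain ⟨φ, hφ⟩ := hdual.exists_factor (LinearMap.applyₗ' Aᵐᵒᵖ p) (by ext f; exact hx f)
  obtain ⟨y, hy⟩ := hK.exists_eval hd φ
  have : p = y := by
    ext i
    have h1 := LinearMap.congr_fun hφ (LinearMap.proj i)
    exact h1.symm.trans (hy _)
  rw [this]
  exact y.2

/-- A finitely generated module with vanishing `Ext^i(-, A)` embeds into a finite free module with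
cokernel again such a module. -/
theorem ExtAcyclic.exists_embedding [IsNoetherianRing A] [IsNoetherianRing Aᵐᵒᵖ] {d : ℕ}
    (hd : HasInjectiveDimensionLT (ModuleCat.of Aᵐᵒᵖ A) d) [Module.Finite A X]
    (hX : ExtAcyclic A X) : ∃ (m : ℕ) (ι : X →ₗ[A] (Fin m → A)), Function.Injective ι ∧
      ExtAcyclic A ((Fin m → A) ⧸ LinearMap.range ι) := by
  have := finite_dual (A := A) (X := X)
  obtain ⟨m, σ, hσ⟩ := Module.Finite.exists_fin' Aᵐᵒᵖ (X →ₗ[A] A)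
  -- The coordinates of ι generate X*, so every functional on X factors through ι.
  let ι : X →ₗ[A] (Fin m → A) := LinearMap.pi fun i => σ (Pi.single i 1)
  have hext : Extends A ι := by
    intro h
    obtain ⟨c, rfl⟩ := hσ h
    refine ⟨∑ i, c i • LinearMap.proj i, ?_⟩
    conv_rhs => rw [pi_eq_sum_univ' c]
    ext x
    simp [ι]
  have hinj : Function.Injective ι := by
    rw [← LinearMap.ker_eq_bot, LinearMap.ker_eq_bot']
    intro x hx
    refine hX.eq_zero_of_forall_dual hd fun f => ?_
    obtain ⟨k, rfl⟩ := hext f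
    simp [hx]
  exact ⟨m, ι, hinj, (isShortExact_range hinj).extAcyclic_right hX extAcyclic_of_projective hext⟩

end Duality

/-! ### Gorenstein projectives as the Ext-acyclic modules -/

section GorensteinProjective

variable {A : Type u} [Ring A]

/-- A finitely generated projective module is a direct summand of a finite free module. -/
theorem exists_retract_pi (Q : Type u) [AddCommGroup Q] [Module A Q] [Module.Finite A Q]
    [Module.Projective A Q] : ∃ (m : ℕ) (s : Q →ₗ[A] (Fin m → A)) (r : (Fin m → A) →ₗ[A] Q),
      r ∘ₗ s = LinearMap.id := by
  obtain ⟨m, r, hr⟩ := Module.Finite.exists_fin' A Q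
  obtain ⟨s, hs⟩ := Module.projective_lifting_property r LinearMap.id hr
  exact ⟨m, s, r, hs⟩

/-- Every element of a type with a left and right total relation lies on a bi-infinite chain. -/
theorem exists_int_chain {S : Type*} {r : S → S → Prop} (hr : ∀ a, ∃ b, r a b)
    (hl : ∀ a, ∃ b, r b a) (a : S) : ∃ c : ℤ → S, c 1 = a ∧ ∀ i, r (c i) (c (i + 1)) := by
  choose f hf using hr
  choose g hg using hl
  let c : ℤ → S := fun i => Int.casesOn i (fun n => f^[n] a) fun n => g^[n + 1] a
  have hc : ∀ i, r (c i) (c (i + 1)) := by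
    rintro (n | n | n)
    · change r (f^[n] a) (f^[n + 1] a)
      rw [Function.iterate_succ_apply']
      exact hf _
    · exact hg a
    · change r (g^[n + 2] a) (g^[n + 1] a)
      rw [Function.iterate_succ_apply' g (n + 1)]
      exact hg _
  -- The shift places `a` at index 1, because the image of the differential `d 0` of a spliced
  -- complex is the term at index 1.
  refine ⟨fun i => c (i - 1), rfl, fun i => ?_⟩
  have := hc (i - 1)
  rwa [show i - 1 + 1 = i + 1 - 1 by ring] at this

/-- A splice datum: short exact sequences `0 → Z i → P i → Z (i + 1) → 0` with finitely generated
projective middle terms along which maps to the ring extend form a complete resolution. -/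
theorem isGorensteinProjective_of_splice (Z P : ℤ → ModuleCat.{u} A)
    (hf : ∀ i, Module.Finite A (P i)) (hp : ∀ i, Module.Projective A (P i))
    (ι : ∀ i, Z i →ₗ[A] P i) (π : ∀ i, P i →ₗ[A] Z (i + 1))
    (h : ∀ i, IsShortExact (ι i) (π i)) (hι : ∀ i, Extends A (ι i)) :
    IsGorensteinProjective A (Z 1) := by
  refine ⟨⟨P, fun i => ι (i + 1) ∘ₗ π i, hf, hp, fun i => ?_, fun Q _ _ i g => ?_⟩, ⟨?_⟩⟩
  · intro y
    have h1 := (h (i + 1)).exact y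
    have h2 : ι (i + 1 + 1) (π (i + 1) y) = 0 ↔ π (i + 1) y = 0 :=
      map_eq_zero_iff _ (h (i + 1 + 1)).injective
    simp only [LinearMap.comp_apply, h2, h1]
    constructor
    · rintro ⟨z, rfl⟩
      obtain ⟨p, rfl⟩ := (h i).surjective z
      exact ⟨p, rfl⟩
    · rintro ⟨p, rfl⟩
      exact ⟨_, rfl⟩
  · constructor
    · intro hg
      obtain ⟨l, rfl⟩ := (h (i + 1)).exists_factor g (by
        ext z
        obtain ⟨p, rfl⟩ := (h i).surjective z
        exact LinearMap.congr_fun hg p)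
      obtain ⟨m, s, r, hrs⟩ := exists_retract_pi (A := A) Q
      obtain ⟨k, rfl⟩ := (hι (i + 1 + 1)).of_retract s r hrs l
      exact ⟨k, rfl⟩
    · rintro ⟨k, rfl⟩
      ext p
      have := (h (i + 1)).exact.apply_apply_eq_zero (π i p)
      simp [this]
  · have : LinearMap.range (ι (0 + 1) ∘ₗ π 0) = LinearMap.range (ι (0 + 1)) := by
      rw [LinearMap.range_comp, LinearMap.range_eq_top.2 (h 0).surjective, Submodule.map_top]
    exact (LinearEquiv.ofInjective (ι (0 + 1)) (h (0 + 1)).injective).trans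
      (LinearEquiv.ofEq _ _ this.symm)

/-- Over a Gorenstein ring, the finitely generated modules with vanishing `Ext^i(-, A)` are
Gorenstein projective. -/
theorem ExtAcyclic.isGorensteinProjective [IsNoetherianRing A] [IsNoetherianRing Aᵐᵒᵖ] {d : ℕ}
    (hd : HasInjectiveDimensionLT (ModuleCat.of Aᵐᵒᵖ A) d) {X : Type u} [AddCommGroup X]
    [Module A X] [Module.Finite A X] (hX : ExtAcyclic A X) : IsGorensteinProjective A X := by
  let S := { M : ModuleCat.{u} A // Module.Finite A M ∧ ExtAcyclic A M }
  let r : S → S → Prop := fun a b => ∃ (m : ℕ) (ι : a.1 →ₗ[A] (Fin m → A))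
    (π : (Fin m → A) →ₗ[A] b.1), IsShortExact ι π
  obtain ⟨c, hc, hr⟩ := exists_int_chain (r := r)
    (fun ⟨M, hM, hM'⟩ => by
      obtain ⟨m, ι, hι, h⟩ := hM'.exists_embedding hd
      exact ⟨⟨ModuleCat.of A ((Fin m → A) ⧸ LinearMap.range ι), inferInstance, h⟩,
        m, ι, _, isShortExact_range hι⟩)
    (fun ⟨M, hM, hM'⟩ => by
      obtain ⟨m, π, hπ, h⟩ := hM'.exists_cover
      exact ⟨⟨ModuleCat.of A (LinearMap.ker π), inferInstance, h⟩, m, _, π, isShortExact_ker hπ⟩)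
    ⟨ModuleCat.of A X, inferInstance, hX⟩
  choose m ι π h using hr
  have : IsGorensteinProjective A (c 1).1 := isGorensteinProjective_of_splice (fun i => (c i).1)
    (fun i => ModuleCat.of A (Fin (m i) → A)) (fun _ => inferInstance) (fun _ => inferInstance)
    ι π h fun i => (h i).extends_of_extVanishes ((c (i + 1)).2.2 0)
  rwa [hc] at this

/-- Exactness under Hom(-, A) gives Ext^1 = 0 for every image; each image is a syzygy of the next,
so higher degrees follow by shifting. -/
theorem CompleteResolution.extVanishes_range (C : CompleteResolution A) (j : ℕ) :
    ∀ i, ExtVanishes A (LinearMap.range (C.d i)) A (j + 1) := by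
  have hse : ∀ i, IsShortExact (LinearMap.range (C.d i)).subtype (C.d (i + 1)).rangeRestrict := by
    intro i
    refine ⟨Subtype.val_injective, fun y => ?_, LinearMap.surjective_rangeRestrict _⟩
    have := C.exact i y
    simpa [Subtype.ext_iff] using this
  have hP : ∀ i j, ExtVanishes A (C.P i) A (j + 1) := fun i j =>
    have := C.projective i
    extVanishes_of_projective j
  induction j with
  | zero =>
    intro i
    -- Two successors put the indices literally in the form used by `hom_exact`, avoiding transport
    -- between terms of the complex.
    obtain ⟨i, rfl⟩ : ∃ k, i = k + 1 := ⟨i - 1, by ring⟩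
    obtain ⟨i, rfl⟩ : ∃ k, i = k + 1 := ⟨i - 1, by ring⟩
    refine (hse (i + 1)).extVanishes_one_of_extends (hP _ 0) fun h => ?_
    obtain ⟨k, hk⟩ := (C.hom_exact (ModuleCat.of A A) inferInstance inferInstance i
      (h ∘ₗ (C.d (i + 1)).rangeRestrict)).1 (by
        ext p
        have := (C.exact i).apply_apply_eq_zero p
        have h0 : (C.d (i + 1)).rangeRestrict (C.d i p) = 0 := Subtype.ext this
        simp [h0])
    refine ⟨k, ?_⟩
    ext ⟨_, y, rfl⟩
    exact LinearMap.congr_fun hk y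
  | succ j ih =>
    intro i
    obtain ⟨i, rfl⟩ : ∃ k, i = k + 1 := ⟨i - 1, by ring⟩
    exact (hse i).extVanishes_right (ih i) (hP _ (j + 1))

theorem IsGorensteinProjective.extAcyclic {X : Type u} [AddCommGroup X] [Module A X]
    (hX : IsGorensteinProjective A X) : ExtAcyclic A X := by
  obtain ⟨C, ⟨e⟩⟩ := hX
  exact fun j => (C.extVanishes_range j 0).congr e.symm

end GorensteinProjective

/-! ### Global dimension from cyclic modules -/

section GlobalDimension

variable {B : Type u} [Ring B]

/-- Baer's criterion is the case n = 0; passing to the cokernel of an embedding into an injective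
lowers n. -/
theorem hasInjectiveDimensionLT_of_ideals (n : ℕ) (N : ModuleCat.{u} B)
    (hN : ∀ I : Ideal B, ExtVanishes B (B ⧸ I) N (n + 1)) : HasInjectiveDimensionLT N (n + 1) := by
  induction n generalizing N with
  | zero =>
    have : Module.Injective B N := Module.Baer.iff_injective.1 fun I g => by
      have h : IsShortExact (Submodule.subtype I) (Submodule.mkQ I) :=
        ⟨Subtype.val_injective, LinearMap.exact_subtype_mkQ I, Submodule.mkQ_surjective I⟩
      obtain ⟨k, rfl⟩ := h.extends_of_extVanishes (hN I) g
      exact ⟨k, fun _ _ => rfl⟩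
    have : Injective N := Module.injective_object_of_injective_module B N
    infer_instance
  | succ n ih =>
    obtain ⟨hJ⟩ := EnoughInjectives.presentation N
    have : Injective hJ.J := hJ.injective
    have hse : (ShortComplex.mk hJ.f (Limits.cokernel.π hJ.f) (Limits.cokernel.condition _)).ShortExact :=
      { exact := ShortComplex.exact_cokernel hJ.f
        mono_f := hJ.mono
        epi_g := inferInstance }
    refine hse.hasInjectiveDimensionLT_X₁ (n + 1) (ih _ fun I => ?_) inferInstance
    refine subsingleton_of_forall_eq 0 fun x => ?_
    obtain ⟨y, rfl⟩ := Ext.covariant_sequence_exact₃ (ModuleCat.of B (B ⧸ I)) hse x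
      (rfl : n + 1 + 1 = n + 1 + 1) ((hN I).elim _ _)
    rw [Ext.eq_zero_of_injective y, Ext.zero_comp]

/-- Auslander's theorem: the global dimension is bounded by the projective dimensions of the
cyclic modules. -/
theorem globalDimension_le_of_ideals (n : ℕ)
    (h : ∀ I : Ideal B, HasProjectiveDimensionLE (ModuleCat.of B (B ⧸ I)) n) :
    globalDimension B ≤ n := by
  refine iSup_le fun M => (projectiveDimension_le_iff M n).2 ?_
  refine hasProjectiveDimensionLT_of_enoughInjectives M (n + 1) fun N => ?_
  have := hasInjectiveDimensionLT_of_ideals n N fun I =>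
    (h I).subsingleton _ _ (n + 1) le_rfl N
  exact this.subsingleton _ _ (n + 1) le_rfl M

end GlobalDimension

/-! ### Syzygies over the endomorphism ring -/

section EndomorphismRing

variable {A : Type u} [Ring A] {E X : Type u} [AddCommGroup E] [Module A E] [AddCommGroup X]
  [Module A X]

/-- `Hom_A(E, X)` is a left module over the opposite of `End_A E`, acting by precomposition. -/
instance homModule : Module (Module.End A E)ᵐᵒᵖ (E →ₗ[A] X) where
  smul c h := h ∘ₗ c.unop
  one_smul _ := rfl
  mul_smul _ _ _ := rfl
  smul_zero _ := rfl
  smul_add _ _ _ := rfl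
  add_smul _ _ h := LinearMap.comp_add _ _ h
  zero_smul h := LinearMap.comp_zero h

theorem op_smul_hom (c : (Module.End A E)ᵐᵒᵖ) (h : E →ₗ[A] X) : c • h = h ∘ₗ c.unop := rfl

/-- The inclusion of `Hom_A(E, K)` into a finite free module, for a submodule `K` of `E ^ r`. -/
def homToPi {r : ℕ} (ι : X →ₗ[A] (Fin r → E)) :
    (E →ₗ[A] X) →ₗ[(Module.End A E)ᵐᵒᵖ] (Fin r → (Module.End A E)ᵐᵒᵖ) where
  toFun h i := MulOpposite.op (LinearMap.proj i ∘ₗ ι ∘ₗ h)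
  map_add' h k := by
    ext i
    exact congrArg MulOpposite.op (by simp [LinearMap.comp_add])
  map_smul' c h := rfl

theorem homToPi_injective {r : ℕ} {ι : X →ₗ[A] (Fin r → E)} (hι : Function.Injective ι) :
    Function.Injective (homToPi ι) := by
  intro h k hhk
  ext x
  apply hι
  ext i
  exact LinearMap.congr_fun (MulOpposite.op_injective (congrFun hhk i)) x

/-- The map `E ^ r → X` given by the images of the basis vectors under `B ^ r → Hom_A(E, X)`, where
`B` is the opposite of `End_A E`. -/
noncomputable def piToModule {r : ℕ}
    (τ : (Fin r → (Module.End A E)ᵐᵒᵖ) →ₗ[(Module.End A E)ᵐᵒᵖ] (E →ₗ[A] X)) :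
    (Fin r → E) →ₗ[A] X :=
  ∑ i, τ (Pi.single i 1) ∘ₗ LinearMap.proj i

/-- A vector of endomorphisms is a map E → E^r. Under this identification every B-linear map B^r →
Hom_A(E, X) is composition with a map E^r → X. -/
theorem piToModule_comp_pi {r : ℕ}
    (τ : (Fin r → (Module.End A E)ᵐᵒᵖ) →ₗ[(Module.End A E)ᵐᵒᵖ] (E →ₗ[A] X))
    (c : Fin r → (Module.End A E)ᵐᵒᵖ) :
    piToModule τ ∘ₗ LinearMap.pi (fun i => (c i).unop) = τ c := by
  conv_rhs => rw [pi_eq_sum_univ' c]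
  simp only [map_sum, map_smul, op_smul_hom]
  ext x
  simp [piToModule]

/-- A module generated by `r` elements that embeds into `Hom_A(E, X)` has as first syzygy
`Hom_A(E, K)` for the kernel `K` of a map `E ^ r → X`. -/
theorem isShortExact_homToPi {M : Type u} [AddCommGroup M] [Module (Module.End A E)ᵐᵒᵖ M]
    {T : M →ₗ[(Module.End A E)ᵐᵒᵖ] (E →ₗ[A] X)} (hT : Function.Injective T) {r : ℕ}
    {σ : (Fin r → (Module.End A E)ᵐᵒᵖ) →ₗ[(Module.End A E)ᵐᵒᵖ] M} (hσ : Function.Surjective σ) :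
    IsShortExact (homToPi (LinearMap.ker (piToModule (T ∘ₗ σ))).subtype) σ := by
  refine ⟨homToPi_injective Subtype.val_injective, fun c => ?_, hσ⟩
  rw [← map_eq_zero_iff T hT, ← LinearMap.comp_apply, ← piToModule_comp_pi]
  constructor
  · intro h
    exact ⟨(LinearMap.pi fun i => (c i).unop).codRestrict _ fun x => LinearMap.congr_fun h x, rfl⟩
  · rintro ⟨h, rfl⟩
    ext x
    exact (h x).2

/-- Hom_A(E, -) carries a summand of E^k to a summand of B^k. -/
theorem InAdd.projective_hom (h : InAdd A E X) :
    Module.Projective (Module.End A E)ᵐᵒᵖ (E →ₗ[A] X) := by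
  obtain ⟨k, N, ⟨e⟩⟩ := h
  let s : (Fin k → (Module.End A E)ᵐᵒᵖ) →ₗ[(Module.End A E)ᵐᵒᵖ] (E →ₗ[A] X) :=
    { toFun := fun c => LinearMap.fst A X N ∘ₗ e.symm.toLinearMap ∘ₗ
        LinearMap.pi fun i => (c i).unop
      map_add' := fun c d => by
        ext x
        simp only [LinearMap.comp_apply, LinearMap.add_apply, LinearEquiv.coe_coe]
        rw [← map_add, ← map_add]
        rfl
      map_smul' := fun _ _ => rfl }
  refine Module.Projective.of_split (homToPi (e.toLinearMap ∘ₗ LinearMap.inl A X N)) s ?_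
  ext h x
  change (e.symm (e (h x, 0))).1 = h x
  simp

/-- If `A` is in `add E`, then a map `E ^ r → X` that is surjective on `Hom_A(E, -)` is
surjective. -/
theorem InAdd.surjective_of_hom (hA : InAdd A E A) {r : ℕ} {G : (Fin r → E) →ₗ[A] X}
    (hG : ∀ h : E →ₗ[A] X, ∃ k : E →ₗ[A] (Fin r → E), G ∘ₗ k = h) : Function.Surjective G := by
  obtain ⟨k, N, ⟨e⟩⟩ := hA
  intro x
  let φ : (Fin k → E) →ₗ[A] X :=
    (LinearMap.toSpanSingleton A X x) ∘ₗ LinearMap.fst A A N ∘ₗ e.symm.toLinearMap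
  -- φ sends the element of E^k representing 1 ∈ A to x; lifting φ through G on each copy of E gives
  -- a preimage of x.
  choose l hl using fun i => hG (φ ∘ₗ LinearMap.single A (fun _ : Fin k => E) i)
  refine ⟨∑ i, l i (e (1, 0) i), ?_⟩
  have h1 : ∀ i, G (l i (e (1, 0) i)) = φ (Pi.single i (e (1, 0) i)) := fun i =>
    LinearMap.congr_fun (hl i) _
  rw [map_sum, Finset.sum_congr rfl fun i _ => h1 i, ← map_sum, Finset.univ_sum_single]
  simp [φ]

/-- The endomorphism ring of a finitely generated module over an Artin algebra is Noetherian. -/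
theorem isNoetherianRing_end_op (R : Type v) [CommRing R] [IsNoetherianRing R] [Algebra R A]
    [Module.Finite R A] [Module.Finite A E] : IsNoetherianRing (Module.End A E)ᵐᵒᵖ := by
  let : Module R E := Module.compHom E (algebraMap R A)
  have : IsScalarTower R A E := IsScalarTower.of_algebraMap_smul fun _ _ => rfl
  have : Module.Finite R E := Module.Finite.trans A E
  have : IsNoetherian R (E →ₗ[R] E) := isNoetherian_linearMap R E E
  have : IsNoetherian R (Module.End A E) :=
    isNoetherian_of_injective (LinearMap.restrictScalarsₗ R A E E R)
      (LinearMap.restrictScalars_injective R)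
  have : IsNoetherian R (Module.End A E)ᵐᵒᵖ :=
    isNoetherian_of_linearEquiv (MulOpposite.opLinearEquiv R)
  exact isNoetherian_of_tower R this

/-- If the first syzygy of `N` has projective dimension at most `m`, then that of `N` is at most
`m + 1`. -/
theorem IsShortExact.hasProjectiveDimensionLE_succ {B : Type u} [Ring B] {L M N : Type u}
    [AddCommGroup L] [Module B L] [AddCommGroup M] [Module B M] [AddCommGroup N] [Module B N]
    {f : L →ₗ[B] M} {g : M →ₗ[B] N} (h : IsShortExact f g) [hM : Module.Projective B M] {m : ℕ}
    (hL : HasProjectiveDimensionLE (ModuleCat.of B L) m) :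
    HasProjectiveDimensionLE (ModuleCat.of B N) (m + 1) := by
  have : Projective (ModuleCat.of B M) := (IsProjective.iff_projective M).1 hM
  have : HasProjectiveDimensionLT (ModuleCat.of B M) (m + 1 + 1) :=
    hasProjectiveDimensionLT_of_ge _ 1 _ (by omega)
  exact h.shortExact.hasProjectiveDimensionLT_X₃ (m + 1) hL this

/-- Taking K inside E^r makes Hom_A(E, K) a submodule of B^r, hence finitely generated. The
resulting cover E^s → K has its kernel inside E^s, so the induction repeats. -/
theorem hasProjectiveDimensionLE_hom [IsNoetherianRing A]
    [IsNoetherianRing (Module.End A E)ᵐᵒᵖ] [Module.Finite A E]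
    (hpow : ∀ r : ℕ, ExtAcyclic A (Fin r → E)) (hA : InAdd A E A)
    (hadd : ∀ (X : Type u) [AddCommGroup X] [Module A X] [Module.Finite A X],
      ExtAcyclic A X → InAdd A E X)
    (m : ℕ) : ∀ {r : ℕ} (K : Submodule A (Fin r → E)),
      (∀ i, m ≤ i → ExtVanishes A K A (i + 1)) →
      HasProjectiveDimensionLE (ModuleCat.of (Module.End A E)ᵐᵒᵖ (E →ₗ[A] K)) m := by
  induction m with
  | zero =>
    intro r K hK
    have := (hadd K fun i => hK i (Nat.zero_le i)).projective_hom
    exact (projective_iff_hasProjectiveDimensionLE_zero _).1 ((IsProjective.iff_projective _).1 this)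
  | succ m ih =>
    intro r K hK
    have : Module.Finite (Module.End A E)ᵐᵒᵖ (E →ₗ[A] K) :=
      Module.Finite.of_injective (homToPi K.subtype) (homToPi_injective Subtype.val_injective)
    obtain ⟨s, σ, hσ⟩ := Module.Finite.exists_fin' (Module.End A E)ᵐᵒᵖ (E →ₗ[A] K)
    have hG : Function.Surjective (piToModule (LinearMap.id ∘ₗ σ)) :=
      hA.surjective_of_hom fun h => by
        obtain ⟨c, rfl⟩ := hσ h
        exact ⟨_, piToModule_comp_pi _ c⟩
    refine (isShortExact_homToPi (T := LinearMap.id) Function.injective_id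
      hσ).hasProjectiveDimensionLE_succ (ih _ fun i hi => ?_)
    exact (isShortExact_ker hG).extVanishes_left (hpow s i) (hK (i + 1) (by omega))

/-- The embedding of a left ideal of the opposite endomorphism ring into `Hom_A(E, E)`. -/
def idealToHom (I : Ideal (Module.End A E)ᵐᵒᵖ) : I →ₗ[(Module.End A E)ᵐᵒᵖ] (E →ₗ[A] E) where
  toFun b := b.1.unop
  map_add' _ _ := rfl
  map_smul' _ _ := rfl

theorem idealToHom_injective (I : Ideal (Module.End A E)ᵐᵒᵖ) :
    Function.Injective (idealToHom I) :=
  fun _ _ h => Subtype.ext (MulOpposite.unop_injective h)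

theorem hasProjectiveDimensionLE_quotient [IsNoetherianRing A]
    [IsNoetherianRing (Module.End A E)ᵐᵒᵖ] [Module.Finite A E]
    (hE : ExtAcyclic A E) (hpow : ∀ r : ℕ, ExtAcyclic A (Fin r → E)) (hA : InAdd A E A)
    (hadd : ∀ (X : Type u) [AddCommGroup X] [Module A X] [Module.Finite A X],
      ExtAcyclic A X → InAdd A E X)
    (n : ℕ) (hn : HasInjectiveDimensionLE (ModuleCat.of A A) (n + 2))
    (I : Ideal (Module.End A E)ᵐᵒᵖ) :
    HasProjectiveDimensionLE (ModuleCat.of (Module.End A E)ᵐᵒᵖ ((Module.End A E)ᵐᵒᵖ ⧸ I))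
      (n + 2) := by
  obtain ⟨r, σ, hσ⟩ := Module.Finite.exists_fin' (Module.End A E)ᵐᵒᵖ I
  have hI : IsShortExact (Submodule.subtype I) (Submodule.mkQ I) :=
    ⟨Subtype.val_injective, LinearMap.exact_subtype_mkQ I, Submodule.mkQ_surjective I⟩
  refine hI.hasProjectiveDimensionLE_succ
    ((isShortExact_homToPi (idealToHom_injective I) hσ).hasProjectiveDimensionLE_succ
      (hasProjectiveDimensionLE_hom hpow hA hadd n _ fun i hi => ?_))
  let G := piToModule (idealToHom I ∘ₗ σ)
  have h1 : IsShortExact (LinearMap.ker G).subtype G.rangeRestrict :=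
    ⟨Subtype.val_injective, fun y => by simp [Subtype.ext_iff], LinearMap.surjective_rangeRestrict G⟩
  have h2 : IsShortExact (LinearMap.range G).subtype (LinearMap.range G).mkQ :=
    ⟨Subtype.val_injective, LinearMap.exact_subtype_mkQ _, Submodule.mkQ_surjective _⟩
  -- Shifting along ker G → E^r → im G and im G → E → coker G moves Ext^{i+1} to Ext^{i+3}, which
  -- vanishes because i ≥ n and id A ≤ n + 2.
  exact h1.extVanishes_left (hpow r i) (h2.extVanishes_left (hE (i + 1))
    (hn.subsingleton _ _ (i + 3) (by omega) _))

end EndomorphismRing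

/-! ### Powers of E in add E, and the main theorem -/

section Main

variable {A E : Type u} [Ring A] [AddCommGroup E] [Module A E]

theorem inAdd_pi (r : ℕ) : InAdd A E (Fin r → E) :=
  ⟨r, ModuleCat.of A PUnit, ⟨LinearEquiv.prodUnique⟩⟩

theorem inAdd_self : InAdd A E E :=
  ⟨1, ModuleCat.of A PUnit,
    ⟨LinearEquiv.prodUnique.trans (LinearEquiv.funUnique (Fin 1) A E).symm⟩⟩

end Main

end GorensteinArtin
/-- `A` is an Artin algebra over the commutative Artinian ring `R`. The endomorphism algebra of the
left `A`-module `E` acts on `E` from the right, so as a ring it is `(Module.End A E)ᵐᵒᵖ`. -/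
theorem corollary3p1 {R : Type v} {A E : Type u} [CommRing R] [IsArtinianRing R] [Ring A]
    [Algebra R A] [Module.Finite R A] [AddCommGroup E] [Module A E] [Module.Finite A E]
    (n : ℕ) (hn : 2 ≤ n) (hG : GorensteinArtin.IsNGorenstein A n)
    (hCM : GorensteinArtin.IsCMFinite A)
    (hE : GorensteinArtin.GorensteinProjectivesEqAdd A E) :
    GorensteinArtin.globalDimension (Module.End A E)ᵐᵒᵖ ≤ n := by
  open GorensteinArtin in
  obtain ⟨n, rfl⟩ := Nat.exists_eq_add_of_le' hn
  have := hG.left_noetherian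
  have := hG.right_noetherian
  have : IsNoetherianRing (Module.End A E)ᵐᵒᵖ := isNoetherianRing_end_op R
  -- Only finiteness on the right matters: d drives the duality argument and does not enter the
  -- bound.
  obtain ⟨d, hd⟩ := (injectiveDimension_ne_top_iff _).1 hG.right_finite.ne
  have hadd : ∀ (X : Type u) [AddCommGroup X] [Module A X] [Module.Finite A X],
      ExtAcyclic A X → InAdd A E X := fun X _ _ _ hX =>
    (hE (ModuleCat.of A X) inferInstance).1 (hX.isGorensteinProjective hd)
  have hacyclic : ∀ (X : Type u) [AddCommGroup X] [Module A X] [Module.Finite A X],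
      InAdd A E X → ExtAcyclic A X := fun X _ _ _ hX =>
    ((hE (ModuleCat.of A X) inferInstance).2 hX).extAcyclic
  exact globalDimension_le_of_ideals (n + 2) (hasProjectiveDimensionLE_quotient
    (hacyclic E inAdd_self) (fun r => hacyclic _ (inAdd_pi r)) (hadd A extAcyclic_of_projective)
    hadd n ((injectiveDimension_le_iff _ _).1 hG.left_le))
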